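/- Let $K$ be an infinite field of arbitrary characteristic and $m,n,r\ge 0$. Let $V=K^{m|n}$ be the superspace with basis $v_1,\dots,v_{m+n}$, where $|i|=0$ for $i\le m$ and $|i|=1$ for $i>m$. For a multi-index $I=(i_1,\dots,i_r)$ write $v_I=v_{i_1}\otimes\cdots\otimes v_{i_r}\in V^{\otimes r}$. The symmetric group $\Sigma_r$ acts on $V^{\otimes r}$ from the right by $v_I\,(j,j+1)=(-1)^{|i_j||i_{j+1}|}v_{I.(j,j+1)}$, where $I.(j,j+1)$ is $I$ with its $j$-th and $(j+1)$-st entries interchanged. Superalgebras are $\mathbb Z/2$-graded algebras, and supercommutative means $ab=(-1)^{|a||b|}ba$ for homogeneous $a,b$ (in every characteristic). Let $GL(m|n)$ be the supergroup of even automorphisms of $V$. Its coordinate superalgebra $K[GL(m|n)]$ is the supercommutative superalgebra generated by the coefficients $c_{ij}$ of $g v_j=\sum_i c_{ij}(g)v_i$ and $d_{ij}$ of $g^{-1}v_j=\sum_i d_{ij}(g)v_i$, of parity $|i|+|j|$, subject to the relations $\sum_k d_{kj}c_{ik}=\delta_{ij}=\sum_k c_{kj}d_{ik}$ expressing that these two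 maps are inverse to each other. Let $\mathfrak m$ be the kernel of the counit (evaluation at the identity) and let $Dist(GL(m|n))$ be the space of all linear functionals on $K[GL(m|n)]$ that vanish on some $\mathfrak m^{k+1}$, $k\ge 0$. It acts on $V^{\otimes r}$ by $$\varphi v_J=\sum_I\varphi(\chi_{IJ})v_I,\qquad \chi_{IJ}=\varepsilon_{IJ}\,c_{i_1j_1}\cdots c_{i_rj_r},\qquad \varepsilon_{IJ}=(-1)^{\sum_{t=1}^r|i_t|(|i_{t+1}|+|j_{t+1}|+\cdots+|i_r|+|j_r|)},$$ where the $\chi_{IJ}$ are the coefficient functions of $g v_J=g v_{j_1}\otimes\cdots\otimes g v_{j_r}$. This gives $\Psi_r:Dist(GL(m|n))\to End_K(V^{\otimes r})$. Its image is the Schur superalgebra $S(m|n,r)$. Let $A(m|n,r)\subseteq K[GL(m|n)]$ be the span of the products of $r$ functions $c_{ij}$, and let $D_r$ be the degree-$r$ component of the supercommutative polynomial superalgebra, that is, of the free algebra on generators $y_{ij}$ ($1\le i,j\le m+n$) modulo the relations $y_{ij}y_{kl}=(-1)^{(|i|+|j|)(|k|+|l|)}y_{kl}y_{ij}$. Then: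 1. $\Psi_r$ maps $Dist(GL(m|n))$ onto the centralizer of the signed action: $S(m|n,r)=End_{K\Sigma_r}(V^{\otimes r})$ inside $End_K(V^{\otimes r})$. 2. In particular $S(m|n,r)$ is a subalgebra of $End_K(V^{\otimes r})$, and there is an isomorphism of $K$-algebras $S(m|n,r)\cong End_{K\Sigma_r}(V^{\otimes r})^{op}$ that preserves parity. 3. Let $E_{IJ}$ be the matrix units $E_{IJ}v_L=\delta_{JL}v_I$, let $F_{IJ}=\varepsilon_{IJ}E_{IJ}$, and let $F_{IJ}^*$ be the dual basis of $End_K(V^{\otimes r})^*$. There is a $K$-linear isomorphism $End_{K\Sigma_r}(V^{\otimes r})^*\to D_r$ that sends the restriction of $F_{IJ}^*$ to $y_{i_1j_1}\cdots y_{i_rj_r}$ for all $I,J$. 4. There is a $K$-linear isomorphism $D_r\to A(m|n,r)$ that sends $y_{i_1j_1}\cdots y_{i_rj_r}$ to $c_{i_1j_1}\cdots c_{i_rj_r}$ for all $I,J$. 5. $S(m|n,r)=A(m|n,r)^*$: there is a $K$-linear isomorphism $S(m|n,r)\to A(m|n,r)^*$ that sends $\Psi_r(\varphi)$ to the restriction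 of $\varphi$ to $A(m|n,r)$ for every $\varphi\in Dist(GL(m|n))$. -/

import Mathlib

open scoped TensorProduct

namespace SuperSchur

noncomputable section

/-! ## The natural supermodule and its tensor powers -/

/-- The index set `{1, …, m + n}` of the standard basis, split into the `m` even indices
(`Sum.inl`) and the `n` odd indices (`Sum.inr`). -/
abbrev Idx (m n : ℕ) : Type := Fin m ⊕ Fin n

/-- The parity `|i| ∈ {0, 1}` of an index. -/
def par {m n : ℕ} : Idx m n → ℕ := Sum.elim (fun _ => 0) (fun _ => 1)

/-- Multi-indices `I = (i_1, …, i_r)`. -/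
abbrev MIdx (m n r : ℕ) : Type := Fin r → Idx m n

/-- The natural supermodule `V = K^{m|n}`, with its standard basis `v_i`. -/
abbrev NatMod (K : Type*) (m n : ℕ) : Type _ := Idx m n → K

/-- The tensor power `V^{⊗ r}`. -/
abbrev Tens (K : Type*) [Field K] (m n r : ℕ) : Type _ := ⨂[K]^r (NatMod K m n)

/-- The basis `v_I = v_{i_1} ⊗ ⋯ ⊗ v_{i_r}` of `V^{⊗ r}`. -/
def tensBasis (K : Type*) [Field K] (m n r : ℕ) : Module.Basis (MIdx m n r) K (Tens K m n r) :=
  Basis.piTensorProduct (fun _ : Fin r => Pi.basisFun K (Idx m n))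

theorem tensBasis_apply (K : Type*) [Field K] (m n r : ℕ) (I : MIdx m n r) :
    tensBasis K m n r I = PiTensorProduct.tprod K (fun t => (Pi.single (I t) 1 : NatMod K m n)) := by
  simp [tensBasis]

/-- The component of parity `a` of `V^{⊗ r}`: the span of the `v_I` with
`|i_1| + ⋯ + |i_r| = a` modulo `2`. -/
def tensPart (K : Type*) [Field K] (m n r : ℕ) (a : ZMod 2) : Submodule K (Tens K m n r) :=
  Submodule.span K
    (tensBasis K m n r '' {I : MIdx m n r | ((∑ t, par (I t) : ℕ) : ZMod 2) = a})

/-- The endomorphisms of parity `a` of the superspace `V^{⊗ r}`. -/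
def endPart (K : Type*) [Field K] (m n r : ℕ) (a : ZMod 2) :
    Submodule K (Module.End K (Tens K m n r)) where
  carrier := {f | ∀ b : ZMod 2, ∀ v ∈ tensPart K m n r b, f v ∈ tensPart K m n r (a + b)}
  add_mem' hf hg b v hv := Submodule.add_mem _ (hf b v hv) (hg b v hv)
  zero_mem' _ _ _ := Submodule.zero_mem _
  smul_mem' c _ hf b v hv := Submodule.smul_mem _ c (hf b v hv)

/-! ## The signed right action of the symmetric group -/

/-- The Koszul sign of the passage from `v_I` to `v_{I ∘ σ}`: a factor `-1` for every inversion of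
`σ` at which two odd vectors are interchanged. -/
def permSign (K : Type*) [Field K] {m n r : ℕ} (I : MIdx m n r) (σ : Equiv.Perm (Fin r)) : K :=
  ∏ s : Fin r, ∏ t ∈ Finset.Ioi s,
    if σ t < σ s then (-1 : K) ^ (par (I (σ s)) * par (I (σ t))) else 1

theorem prod_pairs_comp {K : Type*} [Field K] {r : ℕ} (τ : Equiv.Perm (Fin r))
    (h : Fin r → Fin r → K) (hs : ∀ a b, h a b = h b a) :
    ∏ s : Fin r, ∏ t ∈ Finset.Ioi s, h (τ s) (τ t) = ∏ s : Fin r, ∏ t ∈ Finset.Ioi s, h s t := by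
  rw [Finset.prod_sigma', Finset.prod_sigma']
  refine Finset.prod_bij'
    (fun p _ => if τ p.1 < τ p.2 then ⟨τ p.1, τ p.2⟩ else ⟨τ p.2, τ p.1⟩)
    (fun p _ => if τ.symm p.1 < τ.symm p.2 then ⟨τ.symm p.1, τ.symm p.2⟩
      else ⟨τ.symm p.2, τ.symm p.1⟩) ?_ ?_ ?_ ?_ ?_
  · rintro ⟨a, b⟩ hab
    have hab' : a < b := by simpa using hab
    have hne : τ a ≠ τ b := fun e => hab'.ne (τ.injective e)
    dsimp only
    split_ifs with h1
    · simpa using h1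
    · simpa using lt_of_le_of_ne (not_lt.1 h1) hne.symm
  · rintro ⟨a, b⟩ hab
    have hab' : a < b := by simpa using hab
    have hne : τ.symm a ≠ τ.symm b := fun e => hab'.ne (τ.symm.injective e)
    dsimp only
    split_ifs with h1
    · simpa using h1
    · simpa using lt_of_le_of_ne (not_lt.1 h1) hne.symm
  · rintro ⟨a, b⟩ hab
    have hab' : a < b := by simpa using hab
    dsimp only
    by_cases h1 : τ a < τ b
    · simp [h1, hab']
    · simp [h1, not_lt.2 hab'.le]
  · rintro ⟨a, b⟩ hab
    have hab' : a < b := by simpa using hab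
    dsimp only
    by_cases h1 : τ.symm a < τ.symm b
    · simp [h1, hab']
    · simp [h1, not_lt.2 hab'.le]
  · rintro ⟨a, b⟩ _
    dsimp only
    split_ifs with h1
    · rfl
    · exact hs _ _

theorem permSign_mul (K : Type*) [Field K] {m n r : ℕ} (I : MIdx m n r)
    (σ τ : Equiv.Perm (Fin r)) :
    permSign K I (σ * τ) = permSign K I σ * permSign K (I ∘ σ) τ := by
  have key : permSign K I σ = ∏ s : Fin r, ∏ t ∈ Finset.Ioi s,
      (if (τ s < τ t ∧ σ (τ t) < σ (τ s)) ∨ (τ t < τ s ∧ σ (τ s) < σ (τ t)) then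
        (-1 : K) ^ (par (I (σ (τ s))) * par (I (σ (τ t)))) else 1) := by
    rw [prod_pairs_comp τ (fun a b => if (a < b ∧ σ b < σ a) ∨ (b < a ∧ σ a < σ b) then
        (-1 : K) ^ (par (I (σ a)) * par (I (σ b))) else 1)]
    · refine Finset.prod_congr rfl fun s _ => Finset.prod_congr rfl fun t ht => ?_
      have ht' : s < t := by simpa using ht
      simp [ht', not_lt.2 ht'.le]
    · intro a b
      simp only [mul_comm (par (I (σ a))), or_comm]
  rw [key, permSign, permSign, ← Finset.prod_mul_distrib]
  refine Finset.prod_congr rfl fun s _ => ?_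
  rw [← Finset.prod_mul_distrib]
  refine Finset.prod_congr rfl fun t ht => ?_
  have ht' : s ≠ t := (by simpa using ht : s < t).ne
  have h1 : τ s ≠ τ t := fun e => ht' (τ.injective e)
  have h2 : σ (τ s) ≠ σ (τ t) := fun e => h1 (σ.injective e)
  have hsq : ∀ k : ℕ, (-1 : K) ^ k * (-1) ^ k = 1 := fun k => by
    rw [← mul_pow]; simp
  simp only [Equiv.Perm.coe_mul, Function.comp_apply]
  rcases lt_or_gt_of_ne h1 with h1 | h1 <;> rcases lt_or_gt_of_ne h2 with h2 | h2 <;>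
    simp [h1, h2, not_lt.2 h1.le, not_lt.2 h2.le, hsq]

/-- The signed right action of `Σ_r` on `V^{⊗ r}`, `v_I · σ = ± v_{I ∘ σ}`, as a homomorphism
from the opposite group. -/
def symAction (K : Type*) [Field K] (m n r : ℕ) :
    (Equiv.Perm (Fin r))ᵐᵒᵖ →* Module.End K (Tens K m n r) where
  toFun σ := (tensBasis K m n r).constr K fun I =>
    permSign K I σ.unop • tensBasis K m n r (I ∘ σ.unop)
  map_one' := by
    refine (tensBasis K m n r).ext fun I => ?_
    have h : permSign K I (1 : Equiv.Perm (Fin r)) = 1 := by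
      refine Finset.prod_eq_one fun s _ => Finset.prod_eq_one fun t ht => ?_
      have ht' : s < t := by simpa using ht
      simp [not_lt.2 ht'.le]
    rw [Module.Basis.constr_basis]
    simp [h]
  map_mul' σ τ := by
    refine (tensBasis K m n r).ext fun I => ?_
    rw [Module.End.mul_apply, Module.Basis.constr_basis, Module.Basis.constr_basis, map_smul,
      Module.Basis.constr_basis, smul_smul, MulOpposite.unop_mul, permSign_mul]
    rfl

/-- On a transposition of neighbours the action is
`(v_I) τ_j = (-1)^{|i_j| |i_{j+1}|} v_{I.(j,j+1)}`. -/
theorem symAction_swap (K : Type*) [Field K] (m n r : ℕ) (I : MIdx m n (r + 1)) (j : Fin r) :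
    symAction K m n (r + 1) (MulOpposite.op (Equiv.swap j.castSucc j.succ))
        (tensBasis K m n (r + 1) I) =
      (-1 : K) ^ (par (I j.castSucc) * par (I j.succ)) •
        tensBasis K m n (r + 1) (I ∘ Equiv.swap j.castSucc j.succ) := by
  have h : permSign K I (Equiv.swap j.castSucc j.succ) =
      (-1 : K) ^ (par (I j.castSucc) * par (I j.succ)) := by
    rw [permSign, Finset.prod_eq_single j.castSucc, Finset.prod_eq_single j.succ]
    · simp [mul_comm]
    · intro t ht hne
      have ht' : j.castSucc < t := by simpa using ht
      rw [Equiv.swap_apply_left, Equiv.swap_apply_of_ne_of_ne ht'.ne' hne, if_neg]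
      rw [Fin.lt_def] at ht' ⊢
      simp only [Fin.val_castSucc, Fin.val_succ] at ht' ⊢
      omega
    · simp
    · intro s _ hne
      refine Finset.prod_eq_one fun t ht => if_neg ?_
      have ht' : s < t := by simpa using ht
      have hne' : (s : ℕ) ≠ j := fun e => hne (Fin.ext e)
      simp only [Equiv.swap_apply_def, Fin.ext_iff, Fin.lt_def, Fin.val_castSucc,
        Fin.val_succ] at *
      split_ifs <;> simp <;> omega
    · simp
  rw [symAction, MonoidHom.coe_mk, OneHom.coe_mk, Module.Basis.constr_basis]
  simp [h]

/-- `End_{KΣ_r}(V^{⊗ r})`: the `K`-linear endomorphisms that commute with the signed action of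
`Σ_r`. Multiplication is composition of maps. -/
def symCentralizer (K : Type*) [Field K] (m n r : ℕ) :
    Subalgebra K (Module.End K (Tens K m n r)) :=
  Subalgebra.centralizer K (Set.range (symAction K m n r))

/-! ## The general linear supergroup and its distributions -/

/-- Generators of the coordinate superalgebra of `GL(m|n)`: `c i j` is the coefficient of `v_i` in
`g v_j`, and `d i j` is the coefficient of `v_i` in `g⁻¹ v_j`. -/
inductive GLGen (m n : ℕ) : Type
  | c (i j : Idx m n) : GLGen m n
  | d (i j : Idx m n) : GLGen m n

/-- Both `c i j` and `d i j` have parity `|i| + |j|`. -/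
def GLGen.parity {m n : ℕ} : GLGen m n → ℕ
  | .c i j => par i + par j
  | .d i j => par i + par j

/-- Defining relations of `K[GL(m|n)]`: the generators supercommute, and the linear maps
`v_j ↦ ∑ i, c i j v_i` and `v_j ↦ ∑ i, d i j v_i` (coefficients on the left) are inverse to each
other. -/
inductive GLRel (K : Type*) [Field K] (m n : ℕ) :
    FreeAlgebra K (GLGen m n) → FreeAlgebra K (GLGen m n) → Prop
  | supercomm (x y : GLGen m n) :
      GLRel K m n (FreeAlgebra.ι K x * FreeAlgebra.ι K y)
        ((-1 : K) ^ (x.parity * y.parity) • (FreeAlgebra.ι K y * FreeAlgebra.ι K x))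
  | mul_inv (i j : Idx m n) :
      GLRel K m n (∑ k, FreeAlgebra.ι K (GLGen.d k j) * FreeAlgebra.ι K (GLGen.c i k))
        (if i = j then 1 else 0)
  | inv_mul (i j : Idx m n) :
      GLRel K m n (∑ k, FreeAlgebra.ι K (GLGen.c k j) * FreeAlgebra.ι K (GLGen.d i k))
        (if i = j then 1 else 0)

/-- The coordinate superalgebra `K[GL(m|n)]`. It represents the functor that sends a supercommutative
superalgebra `A` to the group of even `A`-linear automorphisms of `A ⊗ V`. -/
abbrev CoordGL (K : Type*) [Field K] (m n : ℕ) : Type _ := RingQuot (GLRel K m n)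

/-- The coordinate function `c_{ij}` of `GL(m|n)`. -/
def coordC (K : Type*) [Field K] {m n : ℕ} (i j : Idx m n) : CoordGL K m n :=
  RingQuot.mkAlgHom K (GLRel K m n) (FreeAlgebra.ι K (GLGen.c i j))

/-- The monomial `c_{IJ} = c_{i_1 j_1} ⋯ c_{i_r j_r}`. -/
def coordMon (K : Type*) [Field K] {m n r : ℕ} (I J : MIdx m n r) : CoordGL K m n :=
  (List.ofFn fun t => coordC K (I t) (J t)).prod

/-- The values of the generators at the identity element. -/
def genAtOne (K : Type*) [Field K] {m n : ℕ} : GLGen m n → K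
  | .c i j => if i = j then 1 else 0
  | .d i j => if i = j then 1 else 0

theorem genAtOne_eq_zero (K : Type*) [Field K] {m n : ℕ} (x : GLGen m n) (hx : Odd x.parity) :
    genAtOne K x = 0 := by
  rcases x with ⟨i, j⟩ | ⟨i, j⟩ <;>
  · refine if_neg ?_
    rintro rfl
    exact (Nat.not_odd_iff_even.2 ⟨par i, rfl⟩) hx

/-- The counit of `K[GL(m|n)]`: evaluation at the identity element. -/
def counitGL (K : Type*) [Field K] (m n : ℕ) : CoordGL K m n →ₐ[K] K :=
  RingQuot.liftAlgHom K ⟨FreeAlgebra.lift K (genAtOne K), by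
    intro a b hab
    induction hab with
    | supercomm x y =>
      simp only [map_mul, map_smul, FreeAlgebra.lift_ι_apply, smul_eq_mul]
      rcases Nat.even_or_odd (x.parity * y.parity) with h | h
      · rw [h.neg_one_pow, one_mul, mul_comm]
      · rw [genAtOne_eq_zero K x (Nat.odd_mul.1 h).1]
        simp
    | mul_inv i j =>
      simp only [map_sum, map_mul, FreeAlgebra.lift_ι_apply, genAtOne]
      simp [apply_ite]
    | inv_mul i j =>
      simp only [map_sum, map_mul, FreeAlgebra.lift_ι_apply, genAtOne]
      simp [apply_ite]⟩

/-- The underlying superspace of the distribution superalgebra `Dist(GL(m|n))`: the linear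
functionals on `K[GL(m|n)]` that vanish on some power `𝔪^{k+1}` of the augmentation ideal. -/
def distGL (K : Type*) [Field K] (m n : ℕ) : Submodule K (Module.Dual K (CoordGL K m n)) where
  carrier := {φ | ∃ k : ℕ, ∀ f ∈ (LinearMap.ker (counitGL K m n).toLinearMap) ^ (k + 1), φ f = 0}
  add_mem' := by
    rintro φ ψ ⟨k, hk⟩ ⟨l, hl⟩
    have mono : ∀ a b : ℕ, (LinearMap.ker (counitGL K m n).toLinearMap) ^ (a + 1 + b) ≤
        (LinearMap.ker (counitGL K m n).toLinearMap) ^ (a + 1) := by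
      intro a b
      have h1 : (LinearMap.ker (counitGL K m n).toLinearMap) *
          (LinearMap.ker (counitGL K m n).toLinearMap) ≤
          LinearMap.ker (counitGL K m n).toLinearMap := by
        rw [Submodule.mul_le]
        intro x hx y hy
        simp only [LinearMap.mem_ker, AlgHom.toLinearMap_apply] at *
        simp [hx]
      induction b with
      | zero => exact le_rfl
      | succ b ih =>
        refine le_trans ?_ ih
        calc (LinearMap.ker (counitGL K m n).toLinearMap) ^ (a + 1 + (b + 1))
            = (LinearMap.ker (counitGL K m n).toLinearMap) ^ (a + b) *
              ((LinearMap.ker (counitGL K m n).toLinearMap) *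
                (LinearMap.ker (counitGL K m n).toLinearMap)) := by
              rw [← pow_two, ← pow_add]; congr 1; omega
          _ ≤ (LinearMap.ker (counitGL K m n).toLinearMap) ^ (a + b) *
              (LinearMap.ker (counitGL K m n).toLinearMap) := mul_le_mul_right h1 _
          _ = (LinearMap.ker (counitGL K m n).toLinearMap) ^ (a + 1 + b) := by
              rw [← pow_succ]; congr 1; omega
    refine ⟨k + l + 1, fun f hf => ?_⟩
    have e1 : k + l + 1 + 1 = k + 1 + (l + 1) := by omega
    have e2 : k + l + 1 + 1 = l + 1 + (k + 1) := by omega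
    rw [LinearMap.add_apply, hk f (mono k (l + 1) (e1 ▸ hf)), hl f (mono l (k + 1) (e2 ▸ hf)),
      add_zero]
  zero_mem' := ⟨0, fun _ _ => rfl⟩
  smul_mem' := by
    rintro a φ ⟨k, hk⟩
    exact ⟨k, fun f hf => by rw [LinearMap.smul_apply, hk f hf, smul_zero]⟩

/-! ## The Schur superalgebra -/

/-- The sign `(-1)^{∑_t |i_t| (|i_{t+1}| + |j_{t+1}| + ⋯ + |i_r| + |j_r|)}`. -/
def multiSign (K : Type*) [Field K] {m n r : ℕ} (I J : MIdx m n r) : K :=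
  (-1 : K) ^ (∑ s : Fin r, ∑ t ∈ Finset.Ioi s, par (I s) * (par (I t) + par (J t)))

/-- The coefficient functions of the `GL(m|n)`-supermodule `V^{⊗ r}` in the basis `v_I`:
`g v_J = g v_{j_1} ⊗ ⋯ ⊗ g v_{j_r} = ∑_I χ_{IJ}(g) v_I`, where the sign in
`χ_{IJ} = ± c_{IJ}` comes from moving the coefficients `c_{i_t j_t}` to the left past the `v_{i_s}`
with `s < t`. -/
def coeffFn (K : Type*) [Field K] {m n r : ℕ} (I J : MIdx m n r) : CoordGL K m n :=
  multiSign K I J • coordMon K I J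

/-- The action `Ψ_r` of `Dist(GL(m|n))` on `V^{⊗ r}` induced by that of `GL(m|n)`:
`φ v_J = ∑_I φ(χ_{IJ}) v_I`. -/
def distAction (K : Type*) [Field K] (m n r : ℕ) :
    distGL K m n →ₗ[K] Module.End K (Tens K m n r) where
  toFun φ := Matrix.toLin (tensBasis K m n r) (tensBasis K m n r)
    (Matrix.of fun I J => φ.1 (coeffFn K I J))
  map_add' φ ψ := by rw [← map_add]; rfl
  map_smul' a φ := by rw [RingHom.id_apply, ← map_smul]; rfl

/-- The Schur superalgebra `S(m|n,r)`: the image of `Dist(GL(m|n))` in `End_K(V^{⊗ r})`. -/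
def schurSuper (K : Type*) [Field K] (m n r : ℕ) :
    Submodule K (Module.End K (Tens K m n r)) :=
  LinearMap.range (distAction K m n r)

/-- `A(m|n,r)`: the span in `K[GL(m|n)]` of the products of `r` coordinate functions `c_{ij}`. -/
def coordPart (K : Type*) [Field K] (m n r : ℕ) : Submodule K (CoordGL K m n) :=
  Submodule.span K {f | ∃ I J : MIdx m n r, f = coordMon K I J}

theorem coordMon_mem (K : Type*) [Field K] {m n r : ℕ} (I J : MIdx m n r) :
    coordMon K I J ∈ coordPart K m n r :=
  Submodule.subset_span ⟨I, J, rfl⟩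

/-! ## The supercommutative polynomial superalgebra -/

/-- The supercommutativity relations `y_{ij} y_{kl} = (-1)^{|y_{ij}| |y_{kl}|} y_{kl} y_{ij}`, where
`|y_{ij}| = |i| + |j|`. -/
inductive PolyRel (K : Type*) [Field K] (m n : ℕ) :
    FreeAlgebra K (Idx m n × Idx m n) → FreeAlgebra K (Idx m n × Idx m n) → Prop
  | supercomm (i j k l : Idx m n) :
      PolyRel K m n (FreeAlgebra.ι K (i, j) * FreeAlgebra.ι K (k, l))
        ((-1 : K) ^ ((par i + par j) * (par k + par l)) •
          (FreeAlgebra.ι K (k, l) * FreeAlgebra.ι K (i, j)))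

/-- The supercommutative polynomial superalgebra on generators `y_{ij}`. -/
abbrev SuperPoly (K : Type*) [Field K] (m n : ℕ) : Type _ := RingQuot (PolyRel K m n)

/-- The monomial `y_{i_1 j_1} ⋯ y_{i_r j_r}`. -/
def polyMon (K : Type*) [Field K] {m n r : ℕ} (I J : MIdx m n r) : SuperPoly K m n :=
  (List.ofFn fun t => RingQuot.mkAlgHom K (PolyRel K m n) (FreeAlgebra.ι K (I t, J t))).prod

/-- The homogeneous component of degree `r` of the supercommutative polynomial superalgebra. -/
def polyPart (K : Type*) [Field K] (m n r : ℕ) : Submodule K (SuperPoly K m n) :=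
  Submodule.span K {f | ∃ I J : MIdx m n r, f = polyMon K I J}

theorem polyMon_mem (K : Type*) [Field K] {m n r : ℕ} (I J : MIdx m n r) :
    polyMon K I J ∈ polyPart K m n r :=
  Submodule.subset_span ⟨I, J, rfl⟩

/-- The coordinate function of `F_{IJ} = ± E_{IJ}` on `End_K(V^{⊗ r})`, where the `E_{IJ}` are the
matrix units `E_{IJ}(v_L) = δ_{JL} v_I` and the sign is `multiSign`: if `φ = ∑ b_{IJ} F_{IJ}`, its
value at `φ` is `b_{IJ}`. -/
def twistedCoord (K : Type*) [Field K] {m n r : ℕ} (I J : MIdx m n r) :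
    Module.Dual K (Module.End K (Tens K m n r)) where
  toFun φ := multiSign K I J * (tensBasis K m n r).repr (φ (tensBasis K m n r J)) I
  map_add' φ ψ := by simp [mul_add]
  map_smul' a φ := by simp [mul_left_comm]

end

end SuperSchur

namespace SuperSchur

noncomputable section

/-! ## Neumann series over the supercommutative polynomial superalgebra -/

/-! Everything rests on identifying three spaces: the endomorphisms commuting with `Σ_r`, the linear
functionals on `D_r`, and the restrictions of distributions to `A(m|n,r)`.

Write an endomorphism as `∑ b_{IJ} F_{IJ}`. The sign `ε_{IJ}` is chosen so that, under the
interchange of two neighbouring positions in both `I` and `J`, the separate Koszul signs of `v_I`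
and `v_J` turn into the Koszul sign of the two letters of `y_{IJ}` (`multiSign_comp_swap`). Hence
the endomorphism commutes with the neighbouring transpositions, and so with `Σ_r`, exactly when the
family `b_{IJ}` obeys the defining relations of the monomials `y_{IJ}`. Such a family is a
functional on `D_r` (`exists_functional`, `range_endOfFunctional`). This uses only the presentation,
with no monomial basis, so odd squares in characteristic 2 need no special treatment. Double duality
in finite dimension then gives the dual of the centralizer.

The coordinates of `Ψ_r(φ)` are the values `φ(c_{IJ})`, so the image lies in the centralizer. For
the converse, take the point `1 + T y` of the supergroup with values in power series over the
supercommutative polynomials; it is invertible by the Neumann series. It reduces to the identity at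
`T = 0`, so the coefficient of `T ^ r` kills `𝔪^{r+1}`, while it sends `c_{IJ}` to `y_{IJ}`.
Composed with any functional it is therefore a distribution with prescribed values on the `c_{IJ}`.
The same coefficient inverts `y_{IJ} ↦ c_{IJ}` on degree `r`, which yields the isomorphism with
`A(m|n,r)`.

The action of `Σ_r` is by signed permutation matrices, so the ordinary transpose preserves the
centralizer and gives the opposite algebra. -/

/-- The generator `y_{ij}` of the supercommutative polynomial superalgebra. -/
def polyVar (K : Type*) [Field K] {m n : ℕ} (i j : Idx m n) : SuperPoly K m n :=
  RingQuot.mkAlgHom K (PolyRel K m n) (FreeAlgebra.ι K (i, j))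

theorem polyMon_eq (K : Type*) [Field K] {m n r : ℕ} (I J : MIdx m n r) :
    polyMon K I J = (List.ofFn fun t => polyVar K (I t) (J t)).prod := rfl

theorem polyVar_mul (K : Type*) [Field K] {m n : ℕ} (i j k l : Idx m n) :
    polyVar K i j * polyVar K k l =
      (-1 : K) ^ ((par i + par j) * (par k + par l)) • (polyVar K k l * polyVar K i j) := by
  simpa [polyVar] using RingQuot.mkAlgHom_rel K (PolyRel.supercomm (K := K) i j k l)

theorem neg_one_pow_smul_self {K M : Type*} [Field K] [AddCommGroup M] [Module K M]
    (a : ℕ) (x : M) : (-1 : K) ^ a • (-1 : K) ^ a • x = x := by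
  rw [smul_smul, ← mul_pow]
  simp

/-- The `(i, j)` entry of the `p`-th power of the generic matrix `(y_{ij})`, the entries being
multiplied in the opposite algebra. -/
def matPow (K : Type*) [Field K] {m n : ℕ} : ℕ → Idx m n → Idx m n → SuperPoly K m n
  | 0, i, j => if i = j then 1 else 0
  | p + 1, i, j => ∑ k, matPow K p k j * polyVar K i k

theorem matPow_succ (K : Type*) [Field K] {m n : ℕ} (p : ℕ) (i j : Idx m n) :
    matPow K (p + 1) i j = ∑ k, matPow K p k j * polyVar K i k := rfl

/-- The power can be peeled from either end. The two inverse relations of the supergroup need one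
form each. -/
theorem matPow_succ' (K : Type*) [Field K] {m n : ℕ} (p : ℕ) (i j : Idx m n) :
    matPow K (p + 1) i j = ∑ k, polyVar K k j * matPow K p i k := by
  induction p generalizing i j with
  | zero => simp [matPow]
  | succ p ih =>
    calc matPow K (p + 1 + 1) i j
        = ∑ k, (∑ l, polyVar K l j * matPow K p k l) * polyVar K i k :=
          Finset.sum_congr rfl fun k _ => by rw [ih]
      _ = ∑ l, polyVar K l j * ∑ k, matPow K p k l * polyVar K i k := by
          simp_rw [Finset.sum_mul, Finset.mul_sum, mul_assoc]
          exact Finset.sum_comm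

/-- A summand of the power is a path from `i` to `j`. Moving `y` past its letters counts the parity
of each inner index twice, so only the endpoints contribute to the sign. -/
theorem matPow_mul (K : Type*) [Field K] {m n : ℕ} (b : ℕ) (y : SuperPoly K m n)
    (hy : ∀ i j : Idx m n, polyVar K i j * y =
      (-1 : K) ^ ((par i + par j) * b) • (y * polyVar K i j)) (p : ℕ) (i j : Idx m n) :
    matPow K p i j * y = (-1 : K) ^ ((par i + par j) * b) • (y * matPow K p i j) := by
  induction p generalizing i j with
  | zero =>
    by_cases h : i = j
    · subst h
      have : Even ((par i + par i) * b) := (Even.add_self _).mul_right _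
      simp [matPow, this.neg_one_pow]
    · simp [matPow, h]
  | succ p ih =>
    rw [matPow_succ, Finset.sum_mul, Finset.mul_sum, Finset.smul_sum]
    refine Finset.sum_congr rfl fun k _ => ?_
    rw [mul_assoc, hy, mul_smul_comm, ← mul_assoc, ih, smul_mul_assoc, smul_smul, mul_assoc]
    congr 1
    have h : (par i + par k) * b + (par k + par j) * b
        = (par i + par j) * b + (par k * b + par k * b) := by ring
    rw [← pow_add, h, pow_add, (Even.add_self _).neg_one_pow, mul_one]

theorem polyVar_mul_matPow (K : Type*) [Field K] {m n : ℕ} (p : ℕ) (i j k l : Idx m n) :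
    polyVar K k l * matPow K p i j =
      (-1 : K) ^ ((par k + par l) * (par i + par j)) • (matPow K p i j * polyVar K k l) := by
  rw [matPow_mul K (par k + par l) (polyVar K k l) fun i j => polyVar_mul K i j k l,
    mul_comm (par k + par l)]
  exact (neg_one_pow_smul_self (K := K) _ (polyVar K k l * matPow K p i j)).symm

theorem matPow_mul_matPow (K : Type*) [Field K] {m n : ℕ} (p q : ℕ) (i j k l : Idx m n) :
    matPow K p i j * matPow K q k l =
      (-1 : K) ^ ((par i + par j) * (par k + par l)) • (matPow K q k l * matPow K p i j) :=
  matPow_mul K _ _ (fun i j => polyVar_mul_matPow K q k l i j) p i j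

/-- The values of the generators of `K[GL(m|n)]` at the formal point `1 + T y` over the
supercommutative polynomial superalgebra: `c_{ij} ↦ δ_{ij} + T y_{ij}`, while the `d_{ij}` go to the
entries of the inverse matrix. -/
def formalPoint (K : Type*) [Field K] {m n : ℕ} : GLGen m n → PowerSeries (SuperPoly K m n)
  | .c i j => PowerSeries.C (if i = j then 1 else 0) + PowerSeries.C (polyVar K i j) * PowerSeries.X
  | .d i j => PowerSeries.mk fun p => (-1 : K) ^ p • matPow K p i j

theorem powerSeries_mul_eq_smul {K A : Type*} [Field K] [Ring A] [Algebra K A]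
    (f g : PowerSeries A) (c : K)
    (h : ∀ p q, PowerSeries.coeff p f * PowerSeries.coeff q g =
      c • (PowerSeries.coeff q g * PowerSeries.coeff p f)) : f * g = c • (g * f) := by
  ext p
  have hc : PowerSeries.coeff p (c • (g * f)) = c • PowerSeries.coeff p (g * f) := rfl
  rw [hc, PowerSeries.coeff_mul, PowerSeries.coeff_mul, ← Finset.Nat.sum_antidiagonal_swap,
    Finset.smul_sum]
  exact Finset.sum_congr rfl fun x _ => h _ _

/-- Reduces the supercommutation of all generator values, of type `c` or `d`, to that of entries of
matrix powers. -/
theorem formalPoint_coeff (K : Type*) [Field K] {m n : ℕ} (x : GLGen m n) (p : ℕ) :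
    ∃ (q : ℕ) (c : K) (i j : Idx m n), x.parity = par i + par j ∧
      PowerSeries.coeff p (formalPoint K x) = c • matPow K q i j := by
  rcases x with ⟨i, j⟩ | ⟨i, j⟩
  · rcases p with _ | _ | p
    · exact ⟨0, 1, i, j, rfl, by simp [formalPoint, matPow]⟩
    · refine ⟨1, 1, i, j, rfl, ?_⟩
      by_cases h : i = j <;>
        simp [formalPoint, matPow, PowerSeries.coeff_succ_mul_X, PowerSeries.coeff_one, h]
    -- The series for `c` is linear in `T`, so the scalar is 0 here and the exponent 1 is arbitrary.
    · refine ⟨1, 0, i, j, rfl, ?_⟩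
      by_cases h : i = j <;>
        simp [formalPoint, PowerSeries.coeff_succ_mul_X, PowerSeries.coeff_one, h]
  · exact ⟨p, (-1) ^ p, i, j, rfl, by simp [formalPoint]⟩

theorem formalPoint_mul (K : Type*) [Field K] {m n : ℕ} (x y : GLGen m n) :
    formalPoint K x * formalPoint K y =
      (-1 : K) ^ (x.parity * y.parity) • (formalPoint K y * formalPoint K x) := by
  refine powerSeries_mul_eq_smul _ _ _ fun p q => ?_
  obtain ⟨p', c, i, j, hx, hp⟩ := formalPoint_coeff K x p
  obtain ⟨q', d, k, l, hy, hq⟩ := formalPoint_coeff K y q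
  rw [hp, hq, hx, hy, smul_mul_smul_comm, smul_mul_smul_comm, matPow_mul_matPow,
    smul_comm ((-1 : K) ^ _), mul_comm d]

theorem formalPoint_mul_inv (K : Type*) [Field K] {m n : ℕ} (i j : Idx m n) :
    ∑ k, formalPoint K (.d k j) * formalPoint K (.c i k) = if i = j then 1 else 0 := by
  have h : (if i = j then (1 : PowerSeries (SuperPoly K m n)) else 0) =
      PowerSeries.C (if i = j then 1 else 0) := by split_ifs <;> simp
  rw [h]
  ext p
  rw [map_sum]
  simp only [formalPoint, mul_add, ← mul_assoc, map_add, PowerSeries.coeff_mul_C,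
    PowerSeries.coeff_mk]
  rcases p with _ | p
  · simp [matPow]
  · simp only [PowerSeries.coeff_succ_mul_X, PowerSeries.coeff_mul_C, PowerSeries.coeff_mk,
      PowerSeries.coeff_C, Nat.succ_ne_zero, if_false, Finset.sum_add_distrib, smul_mul_assoc]
    -- The sum telescopes: the two contributions to the coefficient of `T ^ (p + 1)` are the same
    -- power of the matrix with opposite signs.
    rw [← Finset.smul_sum, ← Finset.smul_sum, ← matPow_succ]
    simp [pow_succ]

theorem formalPoint_inv_mul (K : Type*) [Field K] {m n : ℕ} (i j : Idx m n) :
    ∑ k, formalPoint K (.c k j) * formalPoint K (.d i k) = if i = j then 1 else 0 := by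
  have h : (if i = j then (1 : PowerSeries (SuperPoly K m n)) else 0) =
      PowerSeries.C (if i = j then 1 else 0) := by split_ifs <;> simp
  rw [h]
  ext p
  rw [map_sum]
  simp only [formalPoint, add_mul, mul_assoc, map_add, PowerSeries.coeff_C_mul,
    PowerSeries.coeff_mk]
  rcases p with _ | p
  · simp [matPow]
  · simp only [PowerSeries.coeff_succ_X_mul, PowerSeries.coeff_mk,
      PowerSeries.coeff_C, Nat.succ_ne_zero, if_false, Finset.sum_add_distrib, mul_smul_comm]
    rw [← Finset.smul_sum, ← Finset.smul_sum, ← matPow_succ']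
    simp [pow_succ]

/-- The homomorphism from `K[GL(m|n)]` that corresponds to the formal point `1 + T y`. -/
def formalHom (K : Type*) [Field K] (m n : ℕ) :
    CoordGL K m n →ₐ[K] PowerSeries (SuperPoly K m n) :=
  RingQuot.liftAlgHom K ⟨FreeAlgebra.lift K (formalPoint K), by
    intro a b hab
    induction hab with
    | supercomm x y =>
      simpa only [map_mul, map_smul, FreeAlgebra.lift_ι_apply] using formalPoint_mul K x y
    | mul_inv i j =>
      simpa [apply_ite] using formalPoint_mul_inv K i j
    | inv_mul i j =>
      simpa [apply_ite] using formalPoint_inv_mul K i j⟩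

theorem formalHom_gen (K : Type*) [Field K] {m n : ℕ} (x : GLGen m n) :
    formalHom K m n (RingQuot.mkAlgHom K (GLRel K m n) (FreeAlgebra.ι K x)) =
      formalPoint K x := by
  rw [formalHom, RingQuot.liftAlgHom_mkAlgHom_apply, FreeAlgebra.lift_ι_apply]

theorem counitGL_gen (K : Type*) [Field K] {m n : ℕ} (x : GLGen m n) :
    counitGL K m n (RingQuot.mkAlgHom K (GLRel K m n) (FreeAlgebra.ι K x)) = genAtOne K x := by
  rw [counitGL, RingQuot.liftAlgHom_mkAlgHom_apply, FreeAlgebra.lift_ι_apply]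

/-- The constant coefficient of a power series as an algebra homomorphism. -/
def constantCoeffAlgHom (K A : Type*) [Field K] [Ring A] [Algebra K A] :
    PowerSeries A →ₐ[K] A :=
  { (PowerSeries.constantCoeff : PowerSeries A →+* A) with
    commutes' := fun c => by
      change PowerSeries.constantCoeff (algebraMap K (PowerSeries A) c) = _
      rw [PowerSeries.algebraMap_apply]
      simp }

theorem formalHom_coeff_zero (K : Type*) [Field K] {m n : ℕ} (f : CoordGL K m n) :
    PowerSeries.coeff 0 (formalHom K m n f) = algebraMap K _ (counitGL K m n f) := by
  have h : (constantCoeffAlgHom K (SuperPoly K m n)).comp (formalHom K m n) =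
      (Algebra.ofId K (SuperPoly K m n)).comp (counitGL K m n) := by
    refine RingQuot.ringQuot_ext' K _ _ ?_
    refine FreeAlgebra.hom_ext (funext fun x => ?_)
    change PowerSeries.constantCoeff (formalHom K m n _) = algebraMap K _ (counitGL K m n _)
    refine (congrArg PowerSeries.constantCoeff (formalHom_gen K x)).trans
      (Eq.trans ?_ (congrArg (algebraMap K (SuperPoly K m n)) (counitGL_gen K x)).symm)
    rcases x with ⟨i, j⟩ | ⟨i, j⟩ <;> by_cases h : i = j <;>
      simp [formalPoint, genAtOne, matPow, h]
  exact (PowerSeries.coeff_zero_eq_constantCoeff_apply _).trans (AlgHom.congr_fun h f)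

/-- The augmentation ideal maps to series without constant term, so its `p`-th power maps to
multiples of `T ^ p`. -/
theorem formalHom_coeff_of_mem_pow (K : Type*) [Field K] {m n : ℕ} (p : ℕ) (f : CoordGL K m n)
    (hf : f ∈ (LinearMap.ker (counitGL K m n).toLinearMap) ^ p) (q : ℕ) (hq : q < p) :
    PowerSeries.coeff q (formalHom K m n f) = 0 := by
  induction p generalizing f q with
  | zero => omega
  | succ p ih =>
    rw [pow_succ] at hf
    induction hf using Submodule.mul_induction_on' with
    | mem_mul_mem a ha b hb =>
      rw [map_mul, PowerSeries.coeff_mul]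
      refine Finset.sum_eq_zero fun x hx => ?_
      have hx' := Finset.HasAntidiagonal.mem_antidiagonal.1 hx
      by_cases h : x.1 < p
      · rw [ih a ha _ h, zero_mul]
      · have h0 : x.2 = 0 := by omega
        have hb' : counitGL K m n b = 0 := hb
        rw [h0, formalHom_coeff_zero, hb', map_zero, mul_zero]
    | add a _ b _ iha ihb => rw [map_add, map_add, iha, ihb, add_zero]

/-- The top coefficient of a product of linear factors is the product of the linear coefficients.
The vanishing above degree `r` is carried along because the recursion for the top coefficient also
meets the next higher coefficient of the tail. -/
theorem coeff_list_prod_linear {A : Type*} [Ring A] {r : ℕ} (a b : Fin r → A) :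
    (∀ q, r < q → PowerSeries.coeff q
      (List.ofFn fun t => PowerSeries.C (a t) + PowerSeries.C (b t) * PowerSeries.X).prod = 0) ∧
    PowerSeries.coeff r
      (List.ofFn fun t => PowerSeries.C (a t) + PowerSeries.C (b t) * PowerSeries.X).prod =
      (List.ofFn b).prod := by
  induction r with
  | zero => simp +contextual [PowerSeries.coeff_one, Nat.pos_iff_ne_zero]
  | succ r ih =>
    obtain ⟨h1, h2⟩ := ih (fun t => a t.succ) (fun t => b t.succ)
    have key : ∀ q, PowerSeries.coeff (q + 1) (List.ofFn fun t =>
        PowerSeries.C (a t) + PowerSeries.C (b t) * PowerSeries.X).prod =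
        a 0 * PowerSeries.coeff (q + 1) (List.ofFn fun t : Fin r =>
          PowerSeries.C (a t.succ) + PowerSeries.C (b t.succ) * PowerSeries.X).prod +
        b 0 * PowerSeries.coeff q (List.ofFn fun t : Fin r =>
          PowerSeries.C (a t.succ) + PowerSeries.C (b t.succ) * PowerSeries.X).prod := by
      intro q
      rw [List.ofFn_succ, List.prod_cons, add_mul, map_add, PowerSeries.coeff_C_mul, mul_assoc,
        PowerSeries.coeff_C_mul, PowerSeries.coeff_succ_X_mul]
    refine ⟨fun q hq => ?_, ?_⟩
    · obtain ⟨q, rfl⟩ : ∃ q', q = q' + 1 := ⟨q - 1, by omega⟩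
      rw [key, h1 _ (by omega), h1 _ (by omega)]
      simp
    · rw [key, h1 _ (by omega), h2, List.ofFn_succ, List.prod_cons]
      simp

/-! ### The coefficient of `T ^ r`, and the comparison of `D_r` with `A(m|n,r)` -/

/-- The coefficient of `T ^ r` of a function at the formal point `1 + T y`. -/
def topCoeff (K : Type*) [Field K] (m n r : ℕ) : CoordGL K m n →ₗ[K] SuperPoly K m n where
  toFun f := PowerSeries.coeff r (formalHom K m n f)
  map_add' f g := by rw [map_add, map_add]
  map_smul' c f := by rw [map_smul]; rfl

theorem topCoeff_coordMon (K : Type*) [Field K] {m n r : ℕ} (I J : MIdx m n r) :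
    topCoeff K m n r (coordMon K I J) = polyMon K I J := by
  change PowerSeries.coeff r (formalHom K m n (coordMon K I J)) = _
  have h : (⇑(formalHom K m n) ∘ fun t => coordC K (I t) (J t)) =
      fun t => formalPoint K (GLGen.c (I t) (J t)) :=
    funext fun t => formalHom_gen K (GLGen.c (I t) (J t))
  rw [coordMon, map_list_prod, List.map_ofFn, h, polyMon_eq]
  exact (coeff_list_prod_linear (fun t => if I t = J t then 1 else 0) _).2

theorem comp_topCoeff_mem_distGL (K : Type*) [Field K] (m n r : ℕ)
    (ψ : Module.Dual K (SuperPoly K m n)) : ψ ∘ₗ topCoeff K m n r ∈ distGL K m n :=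
  ⟨r, fun f hf => by
    have h : topCoeff K m n r f = 0 := formalHom_coeff_of_mem_pow K (r + 1) f hf r (Nat.lt_succ_self r)
    rw [LinearMap.comp_apply, h, map_zero]⟩

/-- The homomorphism of superalgebras with `y_{ij} ↦ c_{ij}`. -/
def polyToCoord (K : Type*) [Field K] (m n : ℕ) : SuperPoly K m n →ₐ[K] CoordGL K m n :=
  RingQuot.liftAlgHom K ⟨FreeAlgebra.lift K fun x => coordC K x.1 x.2, by
    intro a b hab
    induction hab with
    | supercomm i j k l =>
      simpa [coordC, GLGen.parity] using RingQuot.mkAlgHom_rel K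
        (GLRel.supercomm (K := K) (GLGen.c i j) (GLGen.c k l))⟩

theorem polyToCoord_polyMon (K : Type*) [Field K] {m n r : ℕ} (I J : MIdx m n r) :
    polyToCoord K m n (polyMon K I J) = coordMon K I J := by
  rw [polyMon, map_list_prod, List.map_ofFn, coordMon]
  congr 2
  funext t
  simp [polyToCoord, RingQuot.liftAlgHom_mkAlgHom_apply]

/-- This left inverse serves twice: it makes `y_{IJ} ↦ c_{IJ}` injective on degree `r`, and it turns
functionals on `D_r` into distributions. -/
theorem topCoeff_polyToCoord (K : Type*) [Field K] {m n r : ℕ} (x : SuperPoly K m n)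
    (hx : x ∈ polyPart K m n r) : topCoeff K m n r (polyToCoord K m n x) = x := by
  induction hx using Submodule.span_induction with
  | mem x hx =>
    obtain ⟨I, J, rfl⟩ := hx
    rw [polyToCoord_polyMon, topCoeff_coordMon]
  | zero => simp
  | add x y _ _ hx hy => rw [map_add, map_add, hx, hy]
  | smul c x _ hx => rw [map_smul, map_smul, hx]

theorem exists_polyPart_equiv_coordPart (K : Type*) [Field K] (m n r : ℕ) :
    ∃ e : polyPart K m n r ≃ₗ[K] coordPart K m n r,
      (∀ x, (e x : CoordGL K m n) = polyToCoord K m n x) := by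
  have hmap : (polyPart K m n r).map (polyToCoord K m n).toLinearMap = coordPart K m n r := by
    rw [polyPart, coordPart, Submodule.map_span]
    congr 1
    ext f
    constructor
    · rintro ⟨_, ⟨I, J, rfl⟩, rfl⟩
      exact ⟨I, J, polyToCoord_polyMon K I J⟩
    · rintro ⟨I, J, rfl⟩
      exact ⟨_, ⟨I, J, rfl⟩, polyToCoord_polyMon K I J⟩
  have hinj : Function.Injective
      ((polyToCoord K m n).toLinearMap.domRestrict (polyPart K m n r)) := by
    intro x y h
    refine Subtype.ext ?_
    rw [← topCoeff_polyToCoord K x.1 x.2, ← topCoeff_polyToCoord K y.1 y.2]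
    exact congrArg _ h
  have hrange : LinearMap.range
      ((polyToCoord K m n).toLinearMap.domRestrict (polyPart K m n r)) = coordPart K m n r := by
    rw [← hmap, LinearMap.range_domRestrict]
  exact ⟨(LinearEquiv.ofInjective _ hinj).trans (LinearEquiv.ofEq _ _ hrange), fun x => rfl⟩

/-! ## Interchanging neighbours -/

/-- A transposition of neighbours has exactly one inversion, the pair `(a, b)`. -/
theorem prod_inversions_swap {M : Type*} [CommMonoid M] {r : ℕ} (a b : Fin r)
    (hab : (a : ℕ) + 1 = b) (g : Fin r → Fin r → M) :
    (∏ s : Fin r, ∏ t ∈ Finset.Ioi s, if Equiv.swap a b t < Equiv.swap a b s then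
      g (Equiv.swap a b s) (Equiv.swap a b t) else 1) = g b a := by
  have hlt : a < b := by rw [Fin.lt_def]; omega
  rw [Finset.prod_eq_single a, Finset.prod_eq_single b]
  · simp [hlt]
  · intro t ht hne
    have ht' : a < t := by simpa using ht
    rw [Equiv.swap_apply_left, Equiv.swap_apply_of_ne_of_ne ht'.ne' hne, if_neg]
    have hne' : (t : ℕ) ≠ b := fun e => hne (Fin.ext e)
    rw [Fin.lt_def] at ht' ⊢
    omega
  · simp [hlt]
  · intro s _ hne
    refine Finset.prod_eq_one fun t ht => if_neg ?_
    have ht' : s < t := by simpa using ht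
    have hne' : (s : ℕ) ≠ a := fun e => hne (Fin.ext e)
    simp only [Equiv.swap_apply_def, Fin.ext_iff, Fin.lt_def] at *
    split_ifs <;> omega
  · simp

theorem permSign_swap (K : Type*) [Field K] {m n r : ℕ} (I : MIdx m n r) (a b : Fin r)
    (hab : (a : ℕ) + 1 = b) :
    permSign K I (Equiv.swap a b) = (-1 : K) ^ (par (I a) * par (I b)) := by
  rw [permSign, prod_inversions_swap a b hab fun s t => (-1 : K) ^ (par (I s) * par (I t)),
    mul_comm]

/-- Evaluating `h` on pairs sorted increasingly makes it symmetric, and the product is then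
invariant under `σ`. Only inverted pairs need a correction, where `h` is its own inverse. -/
theorem prod_pairs_perm {K : Type*} [Field K] {r : ℕ} (σ : Equiv.Perm (Fin r))
    (h : Fin r → Fin r → K) (hh : ∀ a b, h a b * h a b = 1) :
    ∏ s : Fin r, ∏ t ∈ Finset.Ioi s, h (σ s) (σ t) =
      (∏ s : Fin r, ∏ t ∈ Finset.Ioi s,
        if σ t < σ s then h (σ s) (σ t) * h (σ t) (σ s) else 1) *
      ∏ s : Fin r, ∏ t ∈ Finset.Ioi s, h s t := by
  have e : ∏ s : Fin r, ∏ t ∈ Finset.Ioi s, h s t =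
      ∏ s : Fin r, ∏ t ∈ Finset.Ioi s, if s < t then h s t else h t s := by
    refine Finset.prod_congr rfl fun s _ => Finset.prod_congr rfl fun t ht => ?_
    rw [if_pos (by simpa using ht)]
  rw [e, ← prod_pairs_comp σ (fun a b => if a < b then h a b else h b a),
    ← Finset.prod_mul_distrib]
  · refine Finset.prod_congr rfl fun s _ => ?_
    rw [← Finset.prod_mul_distrib]
    refine Finset.prod_congr rfl fun t ht => ?_
    have hne : σ s ≠ σ t := fun e => (by simpa using ht : s < t).ne (σ.injective e)
    rcases lt_or_gt_of_ne hne with h1 | h1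
    · simp [h1, not_lt.2 h1.le]
    · simp [h1, not_lt.2 h1.le, mul_assoc, hh]
  · intro a b
    rcases lt_trichotomy a b with h1 | rfl | h1
    · simp [h1, not_lt.2 h1.le]
    · rfl
    · simp [h1, not_lt.2 h1.le]

theorem neg_one_pow_mul_self (K : Type*) [Field K] (a : ℕ) : (-1 : K) ^ a * (-1) ^ a = 1 := by
  rw [← mul_pow]
  simp

/-- The Koszul sign of the interchange of the `a`-th and `b`-th factor of `y_{IJ}`. -/
def pairSign (K : Type*) [Field K] {m n r : ℕ} (I J : MIdx m n r) (a b : Fin r) : K :=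
  (-1 : K) ^ ((par (I a) + par (J a)) * (par (I b) + par (J b)))

theorem multiSign_mul_self (K : Type*) [Field K] {m n r : ℕ} (I J : MIdx m n r) :
    multiSign K I J * multiSign K I J = 1 := neg_one_pow_mul_self K _

/-- This is the purpose of `ε_{IJ}`: it converts the signs of the actions on `v_I` and `v_J` into
the sign of supercommuting letters. -/
theorem multiSign_comp_swap (K : Type*) [Field K] {m n r : ℕ} (I J : MIdx m n r) (a b : Fin r)
    (hab : (a : ℕ) + 1 = b) :
    multiSign K (I ∘ Equiv.swap a b) (J ∘ Equiv.swap a b) =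
      (-1 : K) ^ (par (I a) * par (I b)) * (-1 : K) ^ (par (J a) * par (J b)) *
        pairSign K I J a b * multiSign K I J := by
  have e : ∀ I J : MIdx m n r, multiSign K I J = ∏ s : Fin r, ∏ t ∈ Finset.Ioi s,
      (-1 : K) ^ (par (I s) * (par (I t) + par (J t))) := fun I J => by
    simp_rw [multiSign, Finset.prod_pow_eq_pow_sum]
  rw [e I J, e]
  simp only [Function.comp_apply]
  rw [prod_pairs_perm (Equiv.swap a b)
    (fun s t => (-1 : K) ^ (par (I s) * (par (I t) + par (J t))))
    fun _ _ => neg_one_pow_mul_self K _]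
  congr 1
  rw [prod_inversions_swap a b hab (fun s t => (-1 : K) ^ (par (I s) * (par (I t) + par (J t))) *
    (-1 : K) ^ (par (I t) * (par (I s) + par (J s))))]
  -- Modulo 2 both exponents equal `|i_a||j_b| + |i_b||j_a|`: the products `|i_a||i_b|` and
  -- `|j_a||j_b|` cancel.
  simp only [pairSign, ← pow_add]
  refine neg_one_pow_congr ?_
  simp only [Nat.even_add, Nat.even_mul]
  tauto

/-! ## The centralizer in the twisted coordinates -/

theorem symAction_basis (K : Type*) [Field K] {m n r : ℕ} (I : MIdx m n r)
    (σ : Equiv.Perm (Fin r)) :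
    symAction K m n r (MulOpposite.op σ) (tensBasis K m n r I) =
      permSign K I σ • tensBasis K m n r (I ∘ σ) :=
  Module.Basis.constr_basis _ _ _ _

theorem repr_symAction (K : Type*) [Field K] {m n r : ℕ} (I : MIdx m n r)
    (σ : Equiv.Perm (Fin r)) (v : Tens K m n r) :
    (tensBasis K m n r).repr (symAction K m n r (MulOpposite.op σ) v) (I ∘ σ) =
      permSign K I σ * (tensBasis K m n r).repr v I := by
  have h : (tensBasis K m n r).coord (I ∘ σ) ∘ₗ symAction K m n r (MulOpposite.op σ) =
      permSign K I σ • (tensBasis K m n r).coord I := by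
    refine (tensBasis K m n r).ext fun L => ?_
    have hinj : L ∘ σ = I ∘ σ ↔ L = I := σ.surjective.injective_comp_right.eq_iff
    rw [LinearMap.comp_apply, symAction_basis]
    by_cases hL : L = I
    · subst hL
      simp
    · simp [hinj, hL]
  exact LinearMap.congr_fun h v

/-- Compare matrix entries of the two composites in row `I ∘ swap` and column `J`. The signs that
appear all square to 1, so they can be moved across the equation. -/
theorem mul_symAction_eq_iff (K : Type*) [Field K] {m n r : ℕ}
    (φ : Module.End K (Tens K m n r)) (a b : Fin r) (hab : (a : ℕ) + 1 = b) :
    symAction K m n r (MulOpposite.op (Equiv.swap a b)) * φ =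
        φ * symAction K m n r (MulOpposite.op (Equiv.swap a b)) ↔
      ∀ I J : MIdx m n r, twistedCoord K (I ∘ Equiv.swap a b) (J ∘ Equiv.swap a b) φ =
        pairSign K I J a b * twistedCoord K I J φ := by
  have key : ∀ I J : MIdx m n r,
      (tensBasis K m n r).repr ((symAction K m n r (MulOpposite.op (Equiv.swap a b)) * φ)
          (tensBasis K m n r J)) (I ∘ Equiv.swap a b) =
        (tensBasis K m n r).repr ((φ * symAction K m n r (MulOpposite.op (Equiv.swap a b)))
          (tensBasis K m n r J)) (I ∘ Equiv.swap a b) ↔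
      twistedCoord K (I ∘ Equiv.swap a b) (J ∘ Equiv.swap a b) φ =
        pairSign K I J a b * twistedCoord K I J φ := by
    intro I J
    rw [Module.End.mul_apply, Module.End.mul_apply, repr_symAction, symAction_basis, map_smul,
      map_smul, Finsupp.smul_apply, smul_eq_mul, permSign_swap K I a b hab,
      permSign_swap K J a b hab]
    change _ ↔ multiSign K _ _ * _ = _ * (multiSign K I J * _)
    rw [multiSign_comp_swap K I J a b hab]
    generalize (tensBasis K m n r).repr (φ (tensBasis K m n r (J ∘ Equiv.swap a b)))
      (I ∘ Equiv.swap a b) = y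
    generalize (tensBasis K m n r).repr (φ (tensBasis K m n r J)) I = x
    have hI := neg_one_pow_mul_self K (par (I a) * par (I b))
    have hJ := neg_one_pow_mul_self K (par (J a) * par (J b))
    have hp : pairSign K I J a b * pairSign K I J a b = 1 := neg_one_pow_mul_self K _
    have hm := multiSign_mul_self K I J
    generalize (-1 : K) ^ (par (I a) * par (I b)) = i at *
    generalize (-1 : K) ^ (par (J a) * par (J b)) = j at *
    generalize pairSign K I J a b = p at *
    generalize multiSign K I J = e at *
    constructor
    · intro h
      linear_combination (-i * p * e) * h + (p * e * x) * hI
    · intro h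
      linear_combination (-i * p * e) * h + (j * y - i * x) * e * e * hp +
        (j * y - i * x) * hm + j * y * p * p * e * e * hI
  constructor
  · intro h I J
    rw [← key, h]
  · intro h
    refine (tensBasis K m n r).ext fun J => (tensBasis K m n r).ext_elem fun I => ?_
    -- Since `key` reads the row `I ∘ swap`, it is applied to the swapped index; the swap is an
    -- involution.
    have := (key (I ∘ Equiv.swap a b) J).2 (h _ _)
    have hI : (I ∘ Equiv.swap a b) ∘ Equiv.swap a b = I := by
      funext t
      simp
    rwa [hI] at this

/-- Neighbouring transpositions generate the symmetric group as a monoid, and commuting with `φ`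
passes to products. -/
theorem mem_symCentralizer_iff (K : Type*) [Field K] {m n r : ℕ}
    (φ : Module.End K (Tens K m n r)) :
    φ ∈ symCentralizer K m n r ↔
      ∀ a b : Fin r, (a : ℕ) + 1 = b → ∀ I J : MIdx m n r,
        twistedCoord K (I ∘ Equiv.swap a b) (J ∘ Equiv.swap a b) φ =
          pairSign K I J a b * twistedCoord K I J φ := by
  rw [symCentralizer, Subalgebra.mem_centralizer_iff, Set.forall_mem_range]
  constructor
  · intro h a b hab
    exact (mul_symAction_eq_iff K φ a b hab).1 (h _)
  · intro h
    have hσ : ∀ σ : Equiv.Perm (Fin r), symAction K m n r (MulOpposite.op σ) * φ =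
        φ * symAction K m n r (MulOpposite.op σ) := by
      intro σ
      rcases r with _ | r
      · rw [Subsingleton.elim σ 1, MulOpposite.op_one, map_one, one_mul, mul_one]
      · have hmem : σ ∈ Submonoid.closure
            (Set.range fun i : Fin r => Equiv.swap i.castSucc i.succ) := by
          rw [Equiv.Perm.mclosure_swap_castSucc_succ]
          trivial
        induction hmem using Submonoid.closure_induction with
        | mem x hx =>
          obtain ⟨j, rfl⟩ := hx
          exact (mul_symAction_eq_iff K φ _ _ (by simp)).2 (h _ _ (by simp))
        | one => rw [MulOpposite.op_one, map_one, one_mul, mul_one]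
        | mul x y _ _ hx hy =>
          rw [MulOpposite.op_mul, map_mul, mul_assoc, hx, ← mul_assoc, hy, mul_assoc]
    exact fun σ => hσ σ.unop

/-- Strip common first factors until the interchanged pair stands at the front. -/
theorem prod_ofFn_comp_swap {K A : Type*} [Field K] [Ring A] [Algebra K A] {r : ℕ}
    (x : Fin r → A) (a b : Fin r) (hab : (a : ℕ) + 1 = b) (c : K)
    (h : x b * x a = c • (x a * x b)) :
    (List.ofFn (x ∘ Equiv.swap a b)).prod = c • (List.ofFn x).prod := by
  induction r with
  | zero => exact a.elim0
  | succ r ih =>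
    obtain ⟨b, rfl⟩ : ∃ b', b = Fin.succ b' :=
      Fin.exists_succ_eq_of_ne_zero (fun e => by simp [e] at hab) |>.imp fun _ => Eq.symm
    rcases Fin.eq_zero_or_eq_succ a with rfl | ⟨a, rfl⟩
    · rcases r with _ | r
      · exact b.elim0
      · obtain rfl : b = 0 := Fin.ext (by simpa using hab.symm)
        have h2 : ∀ t : Fin r, Equiv.swap (0 : Fin (r + 2)) (Fin.succ 0) t.succ.succ = t.succ.succ :=
          fun t => Equiv.swap_apply_of_ne_of_ne (Fin.succ_ne_zero _)
            fun e => Fin.succ_ne_zero t (Fin.succ_injective _ e)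
        simp only [List.ofFn_succ, List.prod_cons, Function.comp_apply, Equiv.swap_apply_left,
          Equiv.swap_apply_right, h2]
        rw [← mul_assoc, h, smul_mul_assoc, mul_assoc]
    · have h0 : Equiv.swap a.succ b.succ 0 = 0 :=
        Equiv.swap_apply_of_ne_of_ne (Fin.succ_ne_zero _).symm (Fin.succ_ne_zero _).symm
      have hs : ∀ t, Equiv.swap a.succ b.succ t.succ = (Equiv.swap a b t).succ := fun t =>
        ((Fin.succ_injective r).map_swap a b t).symm
      have := ih (fun t => x t.succ) a b (by simpa using hab) h
      simp only [List.ofFn_succ, List.prod_cons, Function.comp_apply, h0, hs]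
      rw [← mul_smul_comm, ← this]
      rfl

theorem polyMon_comp_swap (K : Type*) [Field K] {m n r : ℕ} (I J : MIdx m n r) (a b : Fin r)
    (hab : (a : ℕ) + 1 = b) :
    polyMon K (I ∘ Equiv.swap a b) (J ∘ Equiv.swap a b) = pairSign K I J a b • polyMon K I J := by
  rw [pairSign, mul_comm]
  exact prod_ofFn_comp_swap (fun t => polyVar K (I t) (J t)) a b hab _ (polyVar_mul K _ _ _ _)

/-! ## Linear functionals on the supercommutative polynomial superalgebra -/

/-- The functions on words in the generators `y_{ij}` that transform by the Koszul sign when two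
neighbouring letters are interchanged. -/
def symWords (K : Type*) [Field K] (m n : ℕ) : Submodule K (List (Idx m n × Idx m n) → K) where
  carrier := {f | ∀ (u v : List (Idx m n × Idx m n)) (x y : Idx m n × Idx m n),
    f (u ++ x :: y :: v) =
      (-1 : K) ^ ((par x.1 + par x.2) * (par y.1 + par y.2)) * f (u ++ y :: x :: v)}
  add_mem' hf hg u v x y := by simp [hf u v x y, hg u v x y, mul_add]
  zero_mem' _ _ _ _ := by simp
  smul_mem' c f hf u v x y := by simp [hf u v x y, mul_left_comm]

/-- The action of a generator on functions on words by right translation. -/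
def translate (K : Type*) [Field K] {m n : ℕ} (x : Idx m n × Idx m n) :
    Module.End K (symWords K m n) where
  toFun f := ⟨fun u => f.1 (u ++ [x]), fun u v y z => by
    simpa using f.2 u (v ++ [x]) y z⟩
  map_add' _ _ := rfl
  map_smul' _ _ := rfl

/-- The action of the supercommutative polynomial superalgebra on functions on words. -/
def wordRep (K : Type*) [Field K] (m n : ℕ) :
    SuperPoly K m n →ₐ[K] Module.End K (symWords K m n) :=
  RingQuot.liftAlgHom K ⟨FreeAlgebra.lift K (translate K), by
    intro a b hab
    induction hab with
    | supercomm i j k l =>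
      simp only [map_mul, map_smul, FreeAlgebra.lift_ι_apply]
      refine LinearMap.ext fun f => Subtype.ext (funext fun u => ?_)
      have h := f.2 u [] (i, j) (k, l)
      change f.1 (u ++ [(i, j)] ++ [(k, l)]) = _ * f.1 (u ++ [(k, l)] ++ [(i, j)])
      simpa using h⟩

/-- Evaluated at the empty word, the action recovers the value of `f` at any word. This is how a
function on words becomes a functional on the quotient algebra. -/
theorem wordRep_prod (K : Type*) [Field K] {m n : ℕ} (l u : List (Idx m n × Idx m n))
    (f : symWords K m n) :
    (wordRep K m n (l.map fun x => polyVar K x.1 x.2).prod f).1 u = f.1 (u ++ l) := by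
  induction l generalizing u f with
  | nil => simp
  | cons x l ih =>
    have hx : wordRep K m n (polyVar K x.1 x.2) = translate K x := by
      rw [wordRep, polyVar, RingQuot.liftAlgHom_mkAlgHom_apply, FreeAlgebra.lift_ι_apply]
    rw [List.map_cons, List.prod_cons, map_mul, hx]
    change (wordRep K m n _ f).1 (u ++ [x]) = _
    rw [ih]
    simp

/-- Every family of scalars with the symmetry of the monomials `y_{IJ}` is the family of values
of a linear functional. -/
theorem exists_functional (K : Type*) [Field K] {m n r : ℕ} (B : MIdx m n r → MIdx m n r → K)
    (hB : ∀ a b : Fin r, (a : ℕ) + 1 = b → ∀ I J : MIdx m n r,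
      B (I ∘ Equiv.swap a b) (J ∘ Equiv.swap a b) = pairSign K I J a b * B I J) :
    ∃ ψ : Module.Dual K (SuperPoly K m n), ∀ I J, ψ (polyMon K I J) = B I J := by
  -- Extend the family by zero to words of length other than `r`; interchanging letters preserves
  -- the length, so the symmetry survives.
  let g : List (Idx m n × Idx m n) → K := fun w =>
    if h : w.length = r then
      B (fun t => (w.get (t.cast h.symm)).1) (fun t => (w.get (t.cast h.symm)).2) else 0
  have hg : g ∈ symWords K m n := by
    intro u v x y
    by_cases h : (u ++ y :: x :: v).length = r
    · have h' : (u ++ x :: y :: v).length = r := by simpa using h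
      have hl : u.length + (v.length + 1 + 1) = r := by simpa using h
      let a : Fin r := ⟨u.length, by omega⟩
      let b : Fin r := ⟨u.length + 1, by omega⟩
      have hget : ∀ t : Fin r, (u ++ x :: y :: v).get (t.cast h'.symm) =
          (u ++ y :: x :: v).get ((Equiv.swap a b t).cast h.symm) := by
        intro t
        simp only [List.get_eq_getElem, Fin.val_cast, Equiv.swap_apply_def]
        split_ifs with h1 h2
        · subst h1
          simp [a, b]
        · subst h2
          simp [a, b]
        · have h1' : (t : ℕ) ≠ u.length := fun e => h1 (Fin.ext e)
          have h2' : (t : ℕ) ≠ u.length + 1 := fun e => h2 (Fin.ext e)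
          rcases lt_or_ge (t : ℕ) u.length with h3 | h3
          · simp [h3]
          · obtain ⟨d, hd⟩ : ∃ d, (t : ℕ) = u.length + (d + 2) := ⟨t - u.length - 2, by omega⟩
            simp [hd]
      have key := hB a b rfl (fun t => ((u ++ y :: x :: v).get (t.cast h.symm)).1)
        (fun t => ((u ++ y :: x :: v).get (t.cast h.symm)).2)
      have hx : g (u ++ x :: y :: v) = _ := dif_pos h'
      have hy : g (u ++ y :: x :: v) = _ := dif_pos h
      rw [hx, hy]
      simp only [hget]
      refine key.trans ?_
      congr 1
      simp [pairSign, a, b, mul_comm]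
    · have h' : ¬ (u ++ x :: y :: v).length = r := by simpa using h
      have hx : g (u ++ x :: y :: v) = _ := dif_neg h'
      have hy : g (u ++ y :: x :: v) = _ := dif_neg h
      rw [hx, hy, mul_zero]
  -- The functional is a matrix coefficient: act on `g`, then evaluate at the empty word.
  refine ⟨LinearMap.proj (R := K) (φ := fun _ : List (Idx m n × Idx m n) => K) [] ∘ₗ
    (symWords K m n).subtype ∘ₗ LinearMap.applyₗ (⟨g, hg⟩ : symWords K m n) ∘ₗ
    (wordRep K m n).toLinearMap, fun I J => ?_⟩
  have h := wordRep_prod K (List.ofFn fun t => (I t, J t)) [] ⟨g, hg⟩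
  rw [List.map_ofFn] at h
  refine h.trans ?_
  rw [List.nil_append]
  refine (dif_pos (List.length_ofFn)).trans ?_
  simp

/-! ## The centralizer as a dual space -/

/-- The endomorphism with twisted coordinates `ψ(y_{IJ})`. -/
def endOfFunctional (K : Type*) [Field K] (m n r : ℕ) :
    Module.Dual K (polyPart K m n r) →ₗ[K] Module.End K (Tens K m n r) where
  toFun ψ := Matrix.toLin (tensBasis K m n r) (tensBasis K m n r)
    (Matrix.of fun I J => multiSign K I J * ψ ⟨polyMon K I J, polyMon_mem K I J⟩)
  map_add' φ ψ := by
    rw [← map_add]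
    congr 1
    ext I J
    simp [mul_add]
  map_smul' a φ := by
    rw [RingHom.id_apply, ← map_smul]
    congr 1
    ext I J
    simp [mul_left_comm]

theorem repr_toLin_basis {K ι M : Type*} [Field K] [Fintype ι] [DecidableEq ι] [AddCommGroup M]
    [Module K M] (b : Module.Basis ι K M) (A : Matrix ι ι K) (i j : ι) :
    b.repr (Matrix.toLin b b A (b j)) i = A i j := by
  rw [← LinearMap.toMatrix_apply, LinearMap.toMatrix_toLin]

theorem twistedCoord_endOfFunctional (K : Type*) [Field K] {m n r : ℕ}
    (ψ : Module.Dual K (polyPart K m n r)) (I J : MIdx m n r) :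
    twistedCoord K I J (endOfFunctional K m n r ψ) = ψ ⟨polyMon K I J, polyMon_mem K I J⟩ := by
  change multiSign K I J * (tensBasis K m n r).repr (Matrix.toLin _ _ _ _) I = _
  rw [repr_toLin_basis, Matrix.of_apply, ← mul_assoc, multiSign_mul_self, one_mul]

theorem end_ext_twistedCoord (K : Type*) [Field K] {m n r : ℕ}
    {f g : Module.End K (Tens K m n r)}
    (h : ∀ I J, twistedCoord K I J f = twistedCoord K I J g) : f = g := by
  refine (tensBasis K m n r).ext fun J => (tensBasis K m n r).ext_elem fun I => ?_
  refine mul_left_cancel₀ (a := multiSign K I J) (fun h0 => ?_) (h I J)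
  have := multiSign_mul_self K I J
  simp [h0] at this

theorem polyPart_dual_ext (K : Type*) [Field K] {m n r : ℕ}
    {φ ψ : Module.Dual K (polyPart K m n r)}
    (h : ∀ I J, φ ⟨polyMon K I J, polyMon_mem K I J⟩ = ψ ⟨polyMon K I J, polyMon_mem K I J⟩) :
    φ = ψ := by
  refine LinearMap.ext fun x => ?_
  obtain ⟨x, hx⟩ := x
  induction hx using Submodule.span_induction with
  | mem x hx =>
    obtain ⟨I, J, rfl⟩ := hx
    exact h I J
  | zero => exact (map_zero φ).trans (map_zero ψ).symm
  | add x y hx hy ihx ihy =>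
    exact (map_add φ ⟨x, hx⟩ ⟨y, hy⟩).trans
      ((congrArg₂ (· + ·) ihx ihy).trans (map_add ψ ⟨x, hx⟩ ⟨y, hy⟩).symm)
  | smul c x hx ihx =>
    exact (map_smul φ c ⟨x, hx⟩).trans
      ((congrArg (c • ·) ihx).trans (map_smul ψ c ⟨x, hx⟩).symm)

theorem endOfFunctional_injective (K : Type*) [Field K] (m n r : ℕ) :
    Function.Injective (endOfFunctional K m n r) := fun φ ψ h =>
  polyPart_dual_ext K fun I J => by
    rw [← twistedCoord_endOfFunctional, h, twistedCoord_endOfFunctional]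

/-- The commutation condition on twisted coordinates is the supercommutativity relation on
monomials, so the admissible coordinate families are the functionals on `D_r`. -/
theorem range_endOfFunctional (K : Type*) [Field K] (m n r : ℕ) :
    LinearMap.range (endOfFunctional K m n r) =
      Subalgebra.toSubmodule (symCentralizer K m n r) := by
  ext φ
  rw [Subalgebra.mem_toSubmodule, mem_symCentralizer_iff]
  constructor
  · rintro ⟨ψ, rfl⟩ a b hab I J
    rw [twistedCoord_endOfFunctional, twistedCoord_endOfFunctional, ← smul_eq_mul, ← map_smul]
    exact congrArg ψ (Subtype.ext (polyMon_comp_swap K I J a b hab))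
  · intro h
    obtain ⟨ψ, hψ⟩ := exists_functional K (fun I J => twistedCoord K I J φ) h
    refine ⟨ψ ∘ₗ (polyPart K m n r).subtype, end_ext_twistedCoord K fun I J => ?_⟩
    rw [twistedCoord_endOfFunctional]
    exact hψ I J

/-- The centralizer is the dual space of the degree `r` component of the supercommutative
polynomial superalgebra. -/
def dualEquivCentralizer (K : Type*) [Field K] (m n r : ℕ) :
    Module.Dual K (polyPart K m n r) ≃ₗ[K] symCentralizer K m n r :=
  (LinearEquiv.ofInjective _ (endOfFunctional_injective K m n r)).trans
    (LinearEquiv.ofEq _ _ (range_endOfFunctional K m n r))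

theorem finite_polyPart (K : Type*) [Field K] (m n r : ℕ) :
    Module.Finite K (polyPart K m n r) := by
  have h : {f | ∃ I J : MIdx m n r, f = polyMon K I J} =
      Set.range fun p : MIdx m n r × MIdx m n r => polyMon K p.1 p.2 := by
    ext f
    simp [eq_comm]
  rw [polyPart, h]
  exact Module.Finite.span_of_finite K (Set.finite_range _)

/-- Under the identification of the centralizer with the dual of `D_r`, a twisted coordinate is
evaluation at `y_{IJ}`; finite-dimensional reflexivity does the rest. -/
theorem exists_dual_centralizer_equiv (K : Type*) [Field K] (m n r : ℕ) :
    ∃ e : Module.Dual K (symCentralizer K m n r) ≃ₗ[K] polyPart K m n r,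
      ∀ I J : MIdx m n r,
        e ((twistedCoord K I J).comp (symCentralizer K m n r).val.toLinearMap) =
          ⟨polyMon K I J, polyMon_mem K I J⟩ := by
  have := finite_polyPart K m n r
  have : Module.Free K (polyPart K m n r) := Module.Free.of_divisionRing K (polyPart K m n r)
  refine ⟨(dualEquivCentralizer K m n r).dualMap.trans
    (Module.evalEquiv K (polyPart K m n r)).symm, fun I J => ?_⟩
  rw [LinearEquiv.trans_apply, LinearEquiv.symm_apply_eq]
  exact LinearMap.ext fun ψ => twistedCoord_endOfFunctional K ψ I J

/-! ## The image of the distributions -/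

/-- `Ψ_r(φ)` depends only on `φ` restricted to `A(m|n,r)`, pulled back to `D_r`. -/
theorem distAction_eq (K : Type*) [Field K] {m n r : ℕ} (φ : distGL K m n) :
    distAction K m n r φ = endOfFunctional K m n r
      (φ.1 ∘ₗ (polyToCoord K m n).toLinearMap ∘ₗ (polyPart K m n r).subtype) := by
  change Matrix.toLin _ _ _ = Matrix.toLin _ _ _
  congr 1
  ext I J
  change φ.1 (multiSign K I J • coordMon K I J) =
    multiSign K I J * φ.1 (polyToCoord K m n (polyMon K I J))
  rw [polyToCoord_polyMon, map_smul, smul_eq_mul]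

theorem schurSuper_eq (K : Type*) [Field K] (m n r : ℕ) :
    schurSuper K m n r = Subalgebra.toSubmodule (symCentralizer K m n r) := by
  rw [← range_endOfFunctional]
  refine le_antisymm ?_ ?_
  · rintro _ ⟨φ, rfl⟩
    exact ⟨_, (distAction_eq K φ).symm⟩
  · rintro _ ⟨ψ, rfl⟩
    -- The coefficient of `T ^ r` of a general function need not lie in `D_r`, so `ψ` is first
    -- extended to the whole algebra.
    obtain ⟨ψ', hψ'⟩ := LinearMap.exists_extend ψ
    refine ⟨⟨ψ' ∘ₗ topCoeff K m n r, comp_topCoeff_mem_distGL K m n r ψ'⟩, ?_⟩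
    rw [distAction_eq]
    congr 1
    refine LinearMap.ext fun x => ?_
    change ψ' (topCoeff K m n r (polyToCoord K m n x)) = ψ x
    rw [topCoeff_polyToCoord K x.1 x.2, ← hψ']
    rfl

theorem exists_schurSuper_equiv_dual (K : Type*) [Field K] (m n r : ℕ) :
    ∃ e : schurSuper K m n r ≃ₗ[K] Module.Dual K (coordPart K m n r),
      ∀ (φ : distGL K m n) (f : coordPart K m n r),
        e ⟨distAction K m n r φ, LinearMap.mem_range_self _ φ⟩ f =
          (φ : Module.Dual K (CoordGL K m n)) f := by
  obtain ⟨e, he⟩ := exists_polyPart_equiv_coordPart K m n r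
  refine ⟨(LinearEquiv.ofEq _ _ (schurSuper_eq K m n r)).trans
    ((dualEquivCentralizer K m n r).symm.trans e.symm.dualMap), fun φ f => ?_⟩
  have h : (dualEquivCentralizer K m n r).symm (LinearEquiv.ofEq _ _ (schurSuper_eq K m n r)
      ⟨distAction K m n r φ, LinearMap.mem_range_self _ φ⟩) =
      φ.1 ∘ₗ (polyToCoord K m n).toLinearMap ∘ₗ (polyPart K m n r).subtype := by
    rw [LinearEquiv.symm_apply_eq]
    exact Subtype.ext (distAction_eq K φ)
  rw [LinearEquiv.trans_apply, LinearEquiv.trans_apply, h, LinearEquiv.dualMap_apply]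
  change φ.1 (polyToCoord K m n (e.symm f)) = _
  rw [← he, LinearEquiv.apply_symm_apply]

/-! ## The transpose anti-automorphism -/

/-- The transpose of an endomorphism of `V^{⊗ r}` in the basis `v_I`. -/
def endTranspose (K : Type*) [Field K] (m n r : ℕ) :
    Module.End K (Tens K m n r) →ₗ[K] Module.End K (Tens K m n r) :=
  (Matrix.toLin (tensBasis K m n r) (tensBasis K m n r)).toLinearMap ∘ₗ
    (Matrix.transposeLinearEquiv (MIdx m n r) (MIdx m n r) K K).toLinearMap ∘ₗ
    (LinearMap.toMatrix (tensBasis K m n r) (tensBasis K m n r)).toLinearMap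

theorem endTranspose_apply (K : Type*) [Field K] {m n r : ℕ} (f : Module.End K (Tens K m n r)) :
    endTranspose K m n r f = Matrix.toLin (tensBasis K m n r) (tensBasis K m n r)
      (LinearMap.toMatrix (tensBasis K m n r) (tensBasis K m n r) f).transpose := rfl

theorem endTranspose_repr (K : Type*) [Field K] {m n r : ℕ} (f : Module.End K (Tens K m n r))
    (I J : MIdx m n r) :
    (tensBasis K m n r).repr (endTranspose K m n r f (tensBasis K m n r J)) I =
      (tensBasis K m n r).repr (f (tensBasis K m n r I)) J := by
  rw [endTranspose_apply, repr_toLin_basis, Matrix.transpose_apply, LinearMap.toMatrix_apply]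

theorem endTranspose_endTranspose (K : Type*) [Field K] {m n r : ℕ}
    (f : Module.End K (Tens K m n r)) : endTranspose K m n r (endTranspose K m n r f) = f := by
  refine (tensBasis K m n r).ext fun J => (tensBasis K m n r).ext_elem fun I => ?_
  rw [endTranspose_repr, endTranspose_repr]

theorem endTranspose_mul (K : Type*) [Field K] {m n r : ℕ} (f g : Module.End K (Tens K m n r)) :
    endTranspose K m n r (f * g) = endTranspose K m n r g * endTranspose K m n r f := by
  rw [endTranspose_apply, endTranspose_apply, endTranspose_apply, LinearMap.toMatrix_mul,
    Matrix.transpose_mul, Matrix.toLin_mul (tensBasis K m n r) (tensBasis K m n r)]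
  rfl

theorem endTranspose_one (K : Type*) [Field K] (m n r : ℕ) : endTranspose K m n r 1 = 1 := by
  rw [endTranspose_apply, LinearMap.toMatrix_one, Matrix.transpose_one, Matrix.toLin_one]
  rfl

theorem permSign_one (K : Type*) [Field K] {m n r : ℕ} (I : MIdx m n r) :
    permSign K I 1 = 1 := by
  refine Finset.prod_eq_one fun s _ => Finset.prod_eq_one fun t ht => ?_
  have ht' : s < t := by simpa using ht
  simp [not_lt.2 ht'.le]

theorem permSign_mul_self (K : Type*) [Field K] {m n r : ℕ} (I : MIdx m n r)
    (σ : Equiv.Perm (Fin r)) : permSign K I σ * permSign K I σ = 1 := by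
  rw [permSign, ← Finset.prod_mul_distrib]
  refine Finset.prod_eq_one fun s _ => ?_
  rw [← Finset.prod_mul_distrib]
  refine Finset.prod_eq_one fun t _ => ?_
  split_ifs
  · exact neg_one_pow_mul_self K _
  · exact one_mul 1

theorem permSign_comp_inv (K : Type*) [Field K] {m n r : ℕ} (I : MIdx m n r)
    (σ : Equiv.Perm (Fin r)) : permSign K (I ∘ σ) σ⁻¹ = permSign K I σ := by
  have h := permSign_mul K I σ σ⁻¹
  rw [mul_inv_cancel, permSign_one] at h
  rw [← one_mul (permSign K (I ∘ σ) σ⁻¹), ← permSign_mul_self K I σ, mul_assoc, ← h, mul_one]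

/-- A signed permutation matrix is orthogonal: its transpose is its inverse. -/
theorem endTranspose_symAction (K : Type*) [Field K] {m n r : ℕ} (σ : Equiv.Perm (Fin r)) :
    endTranspose K m n r (symAction K m n r (MulOpposite.op σ)) =
      symAction K m n r (MulOpposite.op σ⁻¹) := by
  refine (tensBasis K m n r).ext fun J => (tensBasis K m n r).ext_elem fun I => ?_
  obtain ⟨J, rfl⟩ : ∃ J', J = J' ∘ σ := ⟨J ∘ ⇑σ⁻¹, by funext t; simp⟩
  have hJ : (J ∘ σ) ∘ ⇑σ⁻¹ = J := by funext t; simp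
  rw [endTranspose_repr, repr_symAction, symAction_basis, hJ, permSign_comp_inv, map_smul,
    Finsupp.smul_apply, smul_eq_mul, Module.Basis.repr_self_apply, Module.Basis.repr_self_apply]
  simp only [eq_comm]

theorem endTranspose_mem (K : Type*) [Field K] {m n r : ℕ} (f : Module.End K (Tens K m n r))
    (hf : f ∈ symCentralizer K m n r) : endTranspose K m n r f ∈ symCentralizer K m n r := by
  rw [symCentralizer, Subalgebra.mem_centralizer_iff, Set.forall_mem_range] at hf ⊢
  intro σ
  -- Transposing reverses products and inverts `σ`, so start from commutation with the inverse.
  have h := congrArg (endTranspose K m n r) (hf (MulOpposite.op σ.unop⁻¹))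
  rw [endTranspose_mul, endTranspose_mul, endTranspose_symAction, inv_inv] at h
  exact h.symm

theorem mem_endPart_iff (K : Type*) [Field K] {m n r : ℕ} (a : ZMod 2)
    (f : Module.End K (Tens K m n r)) :
    f ∈ endPart K m n r a ↔ ∀ I J : MIdx m n r,
      (tensBasis K m n r).repr (f (tensBasis K m n r J)) I ≠ 0 →
        ((∑ t, par (I t) : ℕ) : ZMod 2) = a + ((∑ t, par (J t) : ℕ) : ZMod 2) := by
  constructor
  · intro h I J hIJ
    have := h _ _ (Submodule.subset_span ⟨J, rfl, rfl⟩)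
    rw [tensPart, Module.Basis.mem_span_image] at this
    exact this (Finsupp.mem_support_iff.2 hIJ)
  · intro h b v hv
    change v ∈ (tensPart K m n r (a + b)).comap f
    revert v
    change tensPart K m n r b ≤ _
    rw [tensPart, Submodule.span_le]
    rintro _ ⟨J, hJ, rfl⟩
    change f (tensBasis K m n r J) ∈ tensPart K m n r (a + b)
    rw [tensPart, Module.Basis.mem_span_image]
    intro I hI
    rw [← (show _ = b from hJ)]
    exact h I J (Finsupp.mem_support_iff.1 hI)

theorem endTranspose_mem_endPart_iff (K : Type*) [Field K] {m n r : ℕ} (a : ZMod 2)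
    (f : Module.End K (Tens K m n r)) :
    endTranspose K m n r f ∈ endPart K m n r a ↔ f ∈ endPart K m n r a := by
  -- Transposing exchanges row and column parities; since `a = -a` in `ZMod 2`, their difference
  -- keeps its value.
  have key : ∀ x y : ZMod 2, x = a + y ↔ y = a + x := by
    revert a
    decide
  rw [mem_endPart_iff, mem_endPart_iff, forall_comm]
  simp_rw [endTranspose_repr]
  exact forall_congr' fun I => forall_congr' fun J => imp_congr_right fun _ => key _ _

/-- The transpose as an isomorphism of the centralizer onto its opposite algebra. -/
def centralizerTranspose (K : Type*) [Field K] (m n r : ℕ) :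
    symCentralizer K m n r ≃ₐ[K] (symCentralizer K m n r)ᵐᵒᵖ where
  toFun x := MulOpposite.op ⟨endTranspose K m n r x, endTranspose_mem K _ x.2⟩
  invFun x := ⟨endTranspose K m n r x.unop, endTranspose_mem K _ x.unop.2⟩
  left_inv x := Subtype.ext (endTranspose_endTranspose K _)
  right_inv x := MulOpposite.unop_injective (Subtype.ext (endTranspose_endTranspose K _))
  map_mul' x y := MulOpposite.unop_injective (Subtype.ext (endTranspose_mul K _ _))
  map_add' x y := MulOpposite.unop_injective (Subtype.ext (map_add (endTranspose K m n r) _ _))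
  commutes' c := MulOpposite.unop_injective (Subtype.ext (by
    change endTranspose K m n r (algebraMap K _ c) = algebraMap K _ c
    rw [Algebra.algebraMap_eq_smul_one, map_smul, endTranspose_one]))

end

end SuperSchur

theorem mainTheorem3 (K : Type*) [Field K] [Infinite K] (m n r : ℕ) :
    -- `Ψ_r` maps `Dist(GL(m|n))` onto `End_{KΣ_r}(V^{⊗ r})`
    SuperSchur.schurSuper K m n r
        = Subalgebra.toSubmodule (SuperSchur.symCentralizer K m n r) ∧
    -- `S(m|n,r)` is a superalgebra isomorphic to the opposite of `End_{KΣ_r}(V^{⊗ r})`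
    (∃ S : Subalgebra K (Module.End K (SuperSchur.Tens K m n r)),
      Subalgebra.toSubmodule S = SuperSchur.schurSuper K m n r ∧
      ∃ e : S ≃ₐ[K] (SuperSchur.symCentralizer K m n r)ᵐᵒᵖ,
        ∀ (a : ZMod 2) (x : S),
          (x : Module.End K (SuperSchur.Tens K m n r)) ∈ SuperSchur.endPart K m n r a ↔
            ((e x).unop : Module.End K (SuperSchur.Tens K m n r))
              ∈ SuperSchur.endPart K m n r a) ∧
    -- the dual of the centralizer, through the sign-twisted coordinates, is the degree `r` part
    -- of the supercommutative polynomial superalgebra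
    (∃ e : Module.Dual K (SuperSchur.symCentralizer K m n r) ≃ₗ[K] SuperSchur.polyPart K m n r,
      ∀ I J : SuperSchur.MIdx m n r,
        e ((SuperSchur.twistedCoord K I J).comp
            (SuperSchur.symCentralizer K m n r).val.toLinearMap)
          = ⟨SuperSchur.polyMon K I J, SuperSchur.polyMon_mem K I J⟩) ∧
    -- this degree `r` part is `A(m|n,r)`
    (∃ e : SuperSchur.polyPart K m n r ≃ₗ[K] SuperSchur.coordPart K m n r,
      ∀ I J : SuperSchur.MIdx m n r,
        e ⟨SuperSchur.polyMon K I J, SuperSchur.polyMon_mem K I J⟩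
          = ⟨SuperSchur.coordMon K I J, SuperSchur.coordMon_mem K I J⟩) ∧
    -- `S(m|n,r)` is the dual space of `A(m|n,r)`
    (∃ e : SuperSchur.schurSuper K m n r ≃ₗ[K] Module.Dual K (SuperSchur.coordPart K m n r),
      ∀ (φ : SuperSchur.distGL K m n) (f : SuperSchur.coordPart K m n r),
        e ⟨SuperSchur.distAction K m n r φ, LinearMap.mem_range_self _ φ⟩ f
          = (φ : Module.Dual K (SuperSchur.CoordGL K m n)) f) := by
  open SuperSchur in
  refine ⟨schurSuper_eq K m n r, ⟨symCentralizer K m n r, (schurSuper_eq K m n r).symm,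
    centralizerTranspose K m n r, fun a x => (endTranspose_mem_endPart_iff K a _).symm⟩,
    exists_dual_centralizer_equiv K m n r, ?_, exists_schurSuper_equiv_dual K m n r⟩
  obtain ⟨e, he⟩ := SuperSchur.exists_polyPart_equiv_coordPart K m n r
  exact ⟨e, fun I J => Subtype.ext ((he _).trans (SuperSchur.polyToCoord_polyMon K I J))⟩
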